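/- Let $d\ge 1$ and let $X^{(1)},X^{(2)},\dots$ be i.i.d. copies of a random vector in $\mathbb R^d$ with independent Exponential$(1)$ coordinates. For $n\ge1$ let $$\mathrm{RS}_n=\{x\in\mathbb R^d:\ x_j\ge 0\ \text{for all } j,\ \text{and for no } i\in\{1,\dots,n\}\ \text{is } x_j<X^{(i)}_j \text{ for all } j\},$$ let $F_n$ be the topological boundary of $\mathrm{RS}_n$ relative to the closed positive orthant $[0,\infty)^d$, and let $F_n^-=\min\{x_1+\dots+x_d:\ x\in F_n\}$. Write $\ln_k$ for the $k$-th iterate of the natural logarithm, and "i.o." for "for infinitely many $n$". Then: (a) $P(F_n^-\le \ln n-3\ln_3 n)\to 0$ as $n\to\infty$, and $P(F_n^-\ge \ln n+c_n)\to 0$ for every real sequence $(c_n)$ with $c_n\to\infty$. (b) If $d\ge 2$, then $P(F_n^-\ge \ln n+c\ln_2 n\ \text{i.o.})=0$ for every $c>0$. (c1) $P(F_n^-\le \ln n-3\ln_3 n\ \text{i.o.})=0$. (c2) $P(F_n^-\le \ln n-\ln_3 n\ \text{i.o.})=1$. Consequently, $(F_n^--\ln n)/\ln_2 n\to 0$ in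 probability, and if $d\ge 2$ also $(F_n^--\ln n)/\ln_2 n\to 0$ almost surely. -/

import Mathlib

open MeasureTheory ProbabilityTheory Filter Topology

/-- The closed record-setting region at time `n` of the sequence of observations
`x 0, x 1, x 2, …` in `ℝ^d` (the first `n` observations are `x 0, …, x (n - 1)`): the points `y` of
the closed positive orthant for which no observation up to time `n` strictly exceeds `y` in every
coordinate. -/
def recordRegion {d : ℕ} (x : ℕ → Fin d → ℝ) (n : ℕ) : Set (Fin d → ℝ) :=
  {y | 0 ≤ y ∧ ∀ i < n, ¬ ∀ j, y j < x i j}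

/-- The record-setting frontier at time `n`: the topological boundary of the record-setting region
relative to the closed positive orthant `{y | 0 ≤ y}`. -/
def recordFrontier {d : ℕ} (x : ℕ → Fin d → ℝ) (n : ℕ) : Set (Fin d → ℝ) :=
  Subtype.val '' frontier
    ((Subtype.val : Set.Ici (0 : Fin d → ℝ) → (Fin d → ℝ)) ⁻¹' recordRegion x n)

/-- The minimal coordinate sum on the frontier at time `n`. -/
noncomputable def frontierMin {d : ℕ} (x : ℕ → Fin d → ℝ) (n : ℕ) : ℝ :=
  sInf ((fun y : Fin d → ℝ => ∑ j, y j) '' recordFrontier x n)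

/-- `frontierMin` is an attained minimum as soon as one of the first `n` observations has strictly
positive coordinates. -/
theorem isLeast_frontierMin {d : ℕ} (hd : 1 ≤ d) (x : ℕ → Fin d → ℝ) (n : ℕ)
    (hx : ∃ i < n, ∀ j, 0 < x i j) :
    IsLeast ((fun y : Fin d → ℝ => ∑ j, y j) '' recordFrontier x n) (frontierMin x n) := by
  have hcl : IsClosed (recordFrontier x n) :=
    (isClosed_Ici.isClosedEmbedding_subtypeVal).isClosedMap _ isClosed_frontier
  set M : Fin d → ℝ := fun j => ∑ i ∈ Finset.range n, |x i j| with hM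
  have hle : ∀ i < n, x i ≤ M := fun i hi j =>
    (le_abs_self _).trans (Finset.single_le_sum (f := fun i => |x i j|)
      (fun _ _ => abs_nonneg _) (Finset.mem_range.2 hi))
  have hsub : recordFrontier x n ⊆ Set.Icc 0 M := by
    rintro _ ⟨y, hy, rfl⟩
    refine ⟨y.2, ?_⟩
    by_contra hne
    refine hy.2 ?_
    have hopen : IsOpen {z : Set.Ici (0 : Fin d → ℝ) |
        ∀ i ∈ Finset.range n, ∃ j, x i j < z.1 j} := by
      have heq : {z : Set.Ici (0 : Fin d → ℝ) | ∀ i ∈ Finset.range n, ∃ j, x i j < z.1 j}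
          = ⋂ i ∈ Finset.range n, ⋃ j, {z | x i j < z.1 j} := by ext; simp
      rw [heq]
      refine isOpen_biInter_finset fun i _ => isOpen_iUnion fun j => ?_
      exact isOpen_lt continuous_const ((continuous_apply j).comp continuous_subtype_val)
    refine mem_interior.2 ⟨_, ?_, hopen, ?_⟩
    · intro z hz
      refine ⟨z.2, fun i hi hlt => ?_⟩
      obtain ⟨j, hj⟩ := hz i (Finset.mem_range.2 hi)
      exact lt_asymm hj (hlt j)
    · intro i hi
      by_contra hno
      push Not at hno
      exact hne (le_trans (fun j => hno j) (hle i (Finset.mem_range.1 hi)))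
  have hcomp : IsCompact (recordFrontier x n) := isCompact_Icc.of_isClosed_subset hcl hsub
  have hne : (recordFrontier x n).Nonempty := by
    refine Set.Nonempty.image _ ?_
    have : PreconnectedSpace (Set.Ici (0 : Fin d → ℝ)) :=
      Subtype.preconnectedSpace (convex_Ici 0).isPreconnected
    rw [nonempty_frontier_iff]
    have hM0 : (0 : Fin d → ℝ) ≤ M := fun j => Finset.sum_nonneg fun _ _ => abs_nonneg _
    refine ⟨⟨⟨M, hM0⟩, hM0, fun i hi h => ?_⟩, ?_⟩
    · exact absurd (h ⟨0, hd⟩) (not_lt.2 (hle i hi ⟨0, hd⟩))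
    · intro huniv
      obtain ⟨i, hi, hpos⟩ := hx
      have h0 : (⟨0, le_refl (0 : Fin d → ℝ)⟩ : Set.Ici (0 : Fin d → ℝ)) ∈
        (Subtype.val ⁻¹' recordRegion x n : Set (Set.Ici (0 : Fin d → ℝ))) := by
        rw [huniv]; trivial
      exact h0.2 i hi hpos
  exact (hcomp.image (continuous_finsetSum _ fun j _ => continuous_apply j)).isLeast_sInf
    (hne.image _)

/-! Almost surely the frontier minimum is the least coordinate sum over the whole record region
(`frontierMin_le_iff`), hence nondecreasing in n. The problem becomes which points of a given sum t
are dominated by an observation; a single observation dominates a given point with probability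
e^{-t}.

Low values: rounding up to integer points leaves polynomially many candidates in ln n, each
undominated with probability at most exp(-n e^{-(t+d)}). At t = ln n - 3 ln_3 n this is exp(-c (ln_2
n)^3), which beats every power of ln n, so the bounds are summable along n = 2^k. Monotonicity fills
the dyadic gaps, giving the lower half of (a) and (c1).

High values: F_n^- > s forces every point of sum s to be dominated. One such point gives the upper
half of (a). For (b), m well-separated points are used (`measure_forall_exists_forall_lt_le`):
sharing an observation is costly because of the separation, and m different observations cost (n
e^{-s})^m, again summable along powers of 2.

For (c2), a point on a coordinate axis bounds the minimum by the running maximum of one coordinate.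
That maximum is infinitely often below ln n - ln_3 n, by the second Borel–Cantelli lemma on the
independent blocks between consecutive values of (k!)^2 (`ae_frequently_forall_lt_coord_le`). -/

/-! ### Deterministic geometry of the record region -/

theorem recordRegion_antitone {d : ℕ} (x : ℕ → Fin d → ℝ) : Antitone (recordRegion x) :=
  fun _ _ hmn _ hy => ⟨hy.1, fun i hi => hy.2 i (hi.trans_le hmn)⟩

theorem mem_recordRegion_of_le {d : ℕ} {x : ℕ → Fin d → ℝ} {n : ℕ} {y z : Fin d → ℝ}
    (hy : y ∈ recordRegion x n) (hyz : y ≤ z) : z ∈ recordRegion x n :=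
  ⟨hy.1.trans hyz, fun i hi h => hy.2 i hi fun j => (hyz j).trans_lt (h j)⟩

theorem isClosed_recordRegion {d : ℕ} (x : ℕ → Fin d → ℝ) (n : ℕ) :
    IsClosed (recordRegion x n) := by
  have heq : recordRegion x n
      = Set.Ici 0 ∩ ⋂ i ∈ Finset.range n, (⋂ j, {y : Fin d → ℝ | y j < x i j})ᶜ := by
    ext y
    simp [recordRegion]
  rw [heq]
  refine isClosed_Ici.inter (isClosed_biInter fun i _ => ?_)
  exact (isOpen_iInter_of_finite fun j =>
    isOpen_lt (continuous_apply j) continuous_const).isClosed_compl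

theorem recordFrontier_subset_recordRegion {d : ℕ} (x : ℕ → Fin d → ℝ) (n : ℕ) :
    recordFrontier x n ⊆ recordRegion x n := by
  rintro _ ⟨y, hy, rfl⟩
  exact ((isClosed_recordRegion x n).preimage continuous_subtype_val).frontier_subset hy

/-- Shrink y towards the origin, which lies outside the region. By connectedness of [0,1] the
segment crosses the frontier, and shrinking does not increase the sum. -/
theorem exists_mem_recordFrontier_sum_le {d : ℕ} {x : ℕ → Fin d → ℝ} {n : ℕ}
    (hx : ∃ i < n, ∀ j, 0 < x i j) {y : Fin d → ℝ} (hy : y ∈ recordRegion x n) :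
    ∃ z ∈ recordFrontier x n, ∑ j, z j ≤ ∑ j, y j := by
  let f : Set.Icc (0 : ℝ) 1 → Set.Ici (0 : Fin d → ℝ) := fun s => ⟨s.1 • y, fun j => by
    simpa using mul_nonneg s.2.1 (hy.1 j)⟩
  have hf : Continuous f := by
    refine Continuous.subtype_mk ?_ _
    fun_prop
  have : PreconnectedSpace (Set.Icc (0 : ℝ) 1) :=
    Subtype.preconnectedSpace isPreconnected_Icc
  have hne : (frontier (f ⁻¹' (Subtype.val ⁻¹' recordRegion x n))).Nonempty := by
    rw [nonempty_frontier_iff]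
    refine ⟨⟨⟨1, by simp⟩, ?_⟩, fun huniv => ?_⟩
    · simpa [f] using hy
    · obtain ⟨i, hi, hpos⟩ := hx
      have h0 : (⟨0, by simp⟩ : Set.Icc (0 : ℝ) 1) ∈
        f ⁻¹' (Subtype.val ⁻¹' recordRegion x n) := by rw [huniv]; trivial
      exact h0.2 i hi (by simpa [f] using hpos)
  obtain ⟨s, hs⟩ := hne
  refine ⟨s.1 • y, ⟨f s, hf.frontier_preimage_subset _ hs, rfl⟩, ?_⟩
  refine Finset.sum_le_sum fun j _ => ?_
  simpa using mul_le_of_le_one_left (hy.1 j) s.2.2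

theorem frontierMin_le_iff {d : ℕ} (hd : 1 ≤ d) {x : ℕ → Fin d → ℝ} {n : ℕ}
    (hx : ∃ i < n, ∀ j, 0 < x i j) {t : ℝ} :
    frontierMin x n ≤ t ↔ ∃ y ∈ recordRegion x n, ∑ j, y j ≤ t := by
  have hleast := isLeast_frontierMin hd x n hx
  constructor
  · intro h
    obtain ⟨y, hy, hyF⟩ := hleast.1
    exact ⟨y, recordFrontier_subset_recordRegion x n hy, hyF.trans_le h⟩
  · rintro ⟨y, hy, hyt⟩
    obtain ⟨z, hz, hzy⟩ := exists_mem_recordFrontier_sum_le hx hy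
    exact (hleast.2 ⟨z, hz, rfl⟩).trans (hzy.trans hyt)

theorem frontierMin_mono {d : ℕ} (hd : 1 ≤ d) {x : ℕ → Fin d → ℝ} {m n : ℕ}
    (hx : ∃ i < m, ∀ j, 0 < x i j) (hmn : m ≤ n) : frontierMin x m ≤ frontierMin x n := by
  have hx' : ∃ i < n, ∀ j, 0 < x i j := hx.imp fun i hi => ⟨hi.1.trans_le hmn, hi.2⟩
  obtain ⟨y, hy, hyF⟩ := (frontierMin_le_iff hd hx').1 le_rfl
  exact (frontierMin_le_iff hd hx).2 ⟨y, recordRegion_antitone x hmn hy, hyF⟩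

theorem exists_forall_lt_of_sum_lt_frontierMin {d : ℕ} (hd : 1 ≤ d) {x : ℕ → Fin d → ℝ} {n : ℕ}
    (hx : ∃ i < n, ∀ j, 0 < x i j) {y : Fin d → ℝ} (hy : 0 ≤ y)
    (hyF : ∑ j, y j < frontierMin x n) : ∃ i < n, ∀ j, y j < x i j := by
  by_contra hno
  push Not at hno
  refine hyF.not_ge ((frontierMin_le_iff hd hx).2 ⟨y, ⟨hy, fun i hi h => ?_⟩, le_rfl⟩)
  obtain ⟨j, hj⟩ := hno i hi
  exact hj.not_gt (h j)

/-! ### Domination probabilities and union bounds -/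

theorem expMeasure_one_Ioi {t : ℝ} (ht : 0 ≤ t) :
    expMeasure 1 (Set.Ioi t) = ENNReal.ofReal (Real.exp (-t)) := by
  have := isProbabilityMeasure_expMeasure one_pos
  rw [← Set.compl_Iic, prob_compl_eq_one_sub measurableSet_Iic, ← ofReal_cdf,
    cdf_expMeasure_eq one_pos, if_pos ht, ← ENNReal.ofReal_one,
    ← ENNReal.ofReal_sub _ (by simpa using ht)]
  simp

section

variable {d : ℕ} {Ω : Type*} [MeasurableSpace Ω] {P : Measure Ω}
  {X : ℕ → Ω → Fin d → ℝ}

theorem measurableSet_forall_lt (y : Fin d → ℝ) :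
    MeasurableSet {v : Fin d → ℝ | ∀ j, y j < v j} := by
  rw [Set.ofPred_forall]
  exact MeasurableSet.iInter fun j => measurableSet_lt measurable_const (measurable_pi_apply j)

theorem measure_lt_coord (hX_meas : ∀ i, Measurable (X i))
    (hX_exp : ∀ i j, P.map (fun ω => X i ω j) = expMeasure 1) (i : ℕ) (j : Fin d) {t : ℝ}
    (ht : 0 ≤ t) : P {ω | t < X i ω j} = ENNReal.ofReal (Real.exp (-t)) := by
  have hm : Measurable fun ω => X i ω j := (measurable_pi_apply j).comp (hX_meas i)
  rw [← expMeasure_one_Ioi ht, ← hX_exp i j, Measure.map_apply hm measurableSet_Ioi]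
  rfl

theorem ae_forall_coord_pos [IsProbabilityMeasure P]
    (hX_meas : ∀ i, Measurable (X i))
    (hX_exp : ∀ i j, P.map (fun ω => X i ω j) = expMeasure 1) :
    ∀ᵐ ω ∂P, ∀ i j, 0 < X i ω j := by
  refine ae_all_iff.2 fun i => ae_all_iff.2 fun j => ?_
  have hm : MeasurableSet {ω | 0 < X i ω j} :=
    measurableSet_lt measurable_const ((measurable_pi_apply j).comp (hX_meas i))
  refine (mem_ae_iff_prob_eq_one hm).2 ?_
  rw [measure_lt_coord hX_meas hX_exp i j le_rfl]
  simp

theorem measure_forall_lt [IsProbabilityMeasure P]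
    (hX_meas : ∀ i, Measurable (X i))
    (hX_coord : ∀ i, iIndepFun (fun (j : Fin d) (ω : Ω) => X i ω j) P)
    (hX_exp : ∀ i j, P.map (fun ω => X i ω j) = expMeasure 1) (i : ℕ) {y : Fin d → ℝ}
    (hy : 0 ≤ y) : P {ω | ∀ j, y j < X i ω j} = ENNReal.ofReal (Real.exp (-∑ j, y j)) := by
  have h := (hX_coord i).measure_inter_preimage_eq_mul Finset.univ
    (sets := fun j => Set.Ioi (y j)) fun _ _ => measurableSet_Ioi
  have h1 : {ω | ∀ j, y j < X i ω j}
      = ⋂ j ∈ Finset.univ, (fun ω => X i ω j) ⁻¹' Set.Ioi (y j) := by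
    ext; simp
  rw [h1, h, ← Finset.sum_neg_distrib, Real.exp_sum,
    ENNReal.ofReal_prod_of_nonneg fun _ _ => (Real.exp_pos _).le]
  exact Finset.prod_congr rfl fun j _ => measure_lt_coord hX_meas hX_exp i j (hy j)

theorem measure_exists_forall_lt_le [IsProbabilityMeasure P]
    (hX_meas : ∀ i, Measurable (X i))
    (hX_coord : ∀ i, iIndepFun (fun (j : Fin d) (ω : Ω) => X i ω j) P)
    (hX_exp : ∀ i j, P.map (fun ω => X i ω j) = expMeasure 1) (n : ℕ) {y : Fin d → ℝ}
    (hy : 0 ≤ y) : P {ω | ∃ i < n, ∀ j, y j < X i ω j}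
      ≤ ENNReal.ofReal (n * Real.exp (-∑ j, y j)) := by
  have h1 : {ω | ∃ i < n, ∀ j, y j < X i ω j}
      = ⋃ i ∈ Finset.range n, {ω | ∀ j, y j < X i ω j} := by
    ext; simp
  rw [h1]
  refine (measure_biUnion_finset_le _ _).trans (le_of_eq ?_)
  simp_rw [measure_forall_lt hX_meas hX_coord hX_exp _ hy]
  rw [Finset.sum_const, Finset.card_range, nsmul_eq_mul, ENNReal.ofReal_mul (Nat.cast_nonneg _),
    ENNReal.ofReal_natCast]

theorem measure_not_exists_forall_lt_le [IsProbabilityMeasure P]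
    (hX_meas : ∀ i, Measurable (X i)) (hX_indep : iIndepFun X P)
    (hX_coord : ∀ i, iIndepFun (fun (j : Fin d) (ω : Ω) => X i ω j) P)
    (hX_exp : ∀ i j, P.map (fun ω => X i ω j) = expMeasure 1) (n : ℕ) {y : Fin d → ℝ}
    (hy : 0 ≤ y) : P {ω | ∀ i < n, ¬ ∀ j, y j < X i ω j}
      ≤ ENNReal.ofReal (Real.exp (-(n * Real.exp (-∑ j, y j)))) := by
  have h := hX_indep.measure_inter_preimage_eq_mul (Finset.range n)
    (sets := fun _ => {v : Fin d → ℝ | ∀ j, y j < v j}ᶜ)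
    fun _ _ => (measurableSet_forall_lt y).compl
  have h1 : {ω | ∀ i < n, ¬ ∀ j, y j < X i ω j}
      = ⋂ i ∈ Finset.range n, X i ⁻¹' {v : Fin d → ℝ | ∀ j, y j < v j}ᶜ := by
    ext; simp
  have h2 : ∀ i, P (X i ⁻¹' {v : Fin d → ℝ | ∀ j, y j < v j}ᶜ)
      = ENNReal.ofReal (1 - Real.exp (-∑ j, y j)) := fun i => by
    rw [Set.preimage_compl, prob_compl_eq_one_sub (hX_meas i (measurableSet_forall_lt y)),
      Set.preimage_ofPred_eq, measure_forall_lt hX_meas hX_coord hX_exp i hy,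
      ENNReal.ofReal_sub _ (Real.exp_pos _).le, ENNReal.ofReal_one]
  have hs : Real.exp (-∑ j, y j) ≤ 1 :=
    Real.exp_le_one_iff.2 (neg_nonpos.2 (Finset.sum_nonneg fun j _ => hy j))
  rw [h1, h, Finset.prod_congr rfl fun i _ => h2 i, Finset.prod_const, Finset.card_range,
    ← ENNReal.ofReal_pow (by linarith)]
  refine ENNReal.ofReal_le_ofReal ?_
  rw [neg_mul_eq_mul_neg, Real.exp_nat_mul]
  exact pow_le_pow_left₀ (by linarith) (Real.one_sub_le_exp_neg _) n

/-- Union bound over the integer points of the simplex. -/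
theorem measure_exists_mem_recordRegion_sum_le [IsProbabilityMeasure P]
    (hX_meas : ∀ i, Measurable (X i))
    (hX_indep : iIndepFun X P)
    (hX_coord : ∀ i, iIndepFun (fun (j : Fin d) (ω : Ω) => X i ω j) P)
    (hX_exp : ∀ i j, P.map (fun ω => X i ω j) = expMeasure 1) (n m : ℕ) {t : ℝ} (htm : t ≤ m) :
    P {ω | ∃ y ∈ recordRegion (fun i => X i ω) n, ∑ j, y j ≤ t}
      ≤ ENNReal.ofReal ((m + 1) ^ d * Real.exp (-(n * Real.exp (-(t + d))))) := by
  let p : (Fin d → Fin (m + 1)) → Fin d → ℝ := fun q j => (q j : ℕ)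
  have hp : ∀ q, 0 ≤ p q := fun q j => Nat.cast_nonneg _
  let S : Finset (Fin d → Fin (m + 1)) := Finset.univ.filter fun q => ∑ j, p q j ≤ t + d
  have hsub : {ω | ∃ y ∈ recordRegion (fun i => X i ω) n, ∑ j, y j ≤ t}
      ⊆ ⋃ q ∈ S, {ω | ∀ i < n, ¬ ∀ j, p q j < X i ω j} := by
    rintro ω ⟨y, hy, hyt⟩
    have hyj : ∀ j, y j ≤ m := fun j =>
      (Finset.single_le_sum (fun j _ => hy.1 j) (Finset.mem_univ j)).trans (hyt.trans htm)
    -- The region is closed upwards, so rounding up stays inside; it adds at most d to the sum,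
    -- whence the t + d in the bound.
    let q : Fin d → Fin (m + 1) := fun j => ⟨⌈y j⌉₊, Nat.lt_succ_of_le (Nat.ceil_le.2 (hyj j))⟩
    have hyq : y ≤ p q := fun j => Nat.le_ceil _
    refine Set.mem_biUnion (x := q) ?_ (mem_recordRegion_of_le hy hyq).2
    simp only [S, Finset.coe_filter, Finset.mem_univ, true_and, Set.mem_ofPred_eq]
    calc ∑ j, p q j ≤ ∑ j, (y j + 1) :=
          Finset.sum_le_sum fun j _ => (Nat.ceil_lt_add_one (hy.1 j)).le
      _ = ∑ j, y j + d := by simp [Finset.sum_add_distrib]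
      _ ≤ t + d := by linarith
  have hcard : (S.card : ℝ) ≤ (m + 1) ^ d := by
    have : S.card ≤ (m + 1) ^ d := (Finset.card_filter_le _ _).trans (by simp)
    exact_mod_cast this
  refine (measure_mono hsub).trans ((measure_biUnion_finset_le _ _).trans ?_)
  calc ∑ q ∈ S, P {ω | ∀ i < n, ¬ ∀ j, p q j < X i ω j}
      ≤ ∑ q ∈ S, ENNReal.ofReal (Real.exp (-(n * Real.exp (-(t + d))))) := by
        refine Finset.sum_le_sum fun q hq => ?_
        refine (measure_not_exists_forall_lt_le hX_meas hX_indep hX_coord hX_exp n (hp q)).trans ?_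
        have := (Finset.mem_filter.1 hq).2
        gcongr
    _ = ENNReal.ofReal (S.card * Real.exp (-(n * Real.exp (-(t + d))))) := by
        rw [Finset.sum_const, nsmul_eq_mul, ENNReal.ofReal_mul (Nat.cast_nonneg _),
          ENNReal.ofReal_natCast]
    _ ≤ _ := by gcongr

/-- If several points are all dominated, then either one observation dominates two of them, or
they are dominated by different observations. -/
theorem measure_forall_exists_forall_lt_le [IsProbabilityMeasure P]
    (hX_meas : ∀ i, Measurable (X i))
    (hX_indep : iIndepFun X P)
    (hX_coord : ∀ i, iIndepFun (fun (j : Fin d) (ω : Ω) => X i ω j) P)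
    (hX_exp : ∀ i j, P.map (fun ω => X i ω j) = expMeasure 1) (n m : ℕ) {s δ : ℝ}
    {y : Fin m → Fin d → ℝ} (hy : ∀ l, 0 ≤ y l) (hs : ∀ l, s ≤ ∑ j, y l j)
    (hδ : ∀ l l', l ≠ l' → s + δ ≤ ∑ j, (y l ⊔ y l') j) :
    P {ω | ∀ l, ∃ i < n, ∀ j, y l j < X i ω j}
      ≤ ENNReal.ofReal (m ^ 2 * (n * Real.exp (-(s + δ))) + (n * Real.exp (-s)) ^ m) := by
  classical
  let T : Finset (Fin m × Fin m) := Finset.univ.filter fun q => q.1 ≠ q.2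
  let S : Finset (Fin m → Fin n) := Finset.univ.filter Function.Injective
  have hsub : {ω | ∀ l, ∃ i < n, ∀ j, y l j < X i ω j}
      ⊆ (⋃ q ∈ T, {ω | ∃ i < n, ∀ j, (y q.1 ⊔ y q.2) j < X i ω j}) ∪
        ⋃ f ∈ S, ⋂ l ∈ Finset.univ, X (f l) ⁻¹' {v | ∀ j, y l j < v j} := by
    intro ω hω
    choose f hfn hf using hω
    by_cases hinj : Function.Injective f
    · refine Or.inr (Set.mem_biUnion (x := fun l => ⟨f l, hfn l⟩) ?_ ?_)
      · simp only [S, Finset.coe_filter, Finset.mem_univ, true_and, Set.mem_ofPred_eq]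
        exact fun a b hab => hinj (by simpa using hab)
      · simpa using hf
    · left
      simp only [Function.Injective, not_forall] at hinj
      obtain ⟨a, b, hab, hne⟩ := hinj
      refine Set.mem_biUnion (x := (a, b)) (by simpa [T] using hne) ⟨f a, hfn a, fun j => ?_⟩
      exact max_lt (hf a j) (by rw [hab]; exact hf b j)
  have hT : P (⋃ q ∈ T, {ω | ∃ i < n, ∀ j, (y q.1 ⊔ y q.2) j < X i ω j})
      ≤ ENNReal.ofReal (m ^ 2 * (n * Real.exp (-(s + δ)))) := by
    have hcard : (T.card : ℝ) ≤ m ^ 2 := by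
      have : T.card ≤ m ^ 2 := (Finset.card_filter_le _ _).trans (by simp [sq])
      exact_mod_cast this
    calc _ ≤ ∑ q ∈ T, P {ω | ∃ i < n, ∀ j, (y q.1 ⊔ y q.2) j < X i ω j} :=
          measure_biUnion_finset_le _ _
      _ ≤ ∑ q ∈ T, ENNReal.ofReal (n * Real.exp (-(s + δ))) := by
          refine Finset.sum_le_sum fun q hq => ?_
          refine (measure_exists_forall_lt_le hX_meas hX_coord hX_exp n
            ((hy q.1).trans le_sup_left)).trans ?_
          have := hδ q.1 q.2 (Finset.mem_filter.1 hq).2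
          gcongr
      _ = ENNReal.ofReal (T.card * (n * Real.exp (-(s + δ)))) := by
          rw [Finset.sum_const, nsmul_eq_mul, ENNReal.ofReal_mul (Nat.cast_nonneg T.card),
            ENNReal.ofReal_natCast]
      _ ≤ _ := by gcongr
  have hS : P (⋃ f ∈ S, ⋂ l ∈ Finset.univ, X (f l) ⁻¹' {v | ∀ j, y l j < v j})
      ≤ ENNReal.ofReal ((n * Real.exp (-s)) ^ m) := by
    have hcard : (S.card : ℝ) ≤ n ^ m := by
      have : S.card ≤ n ^ m := (Finset.card_filter_le _ _).trans (by simp)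
      exact_mod_cast this
    calc _ ≤ ∑ f ∈ S, P (⋂ l ∈ Finset.univ, X (f l) ⁻¹' {v | ∀ j, y l j < v j}) :=
          measure_biUnion_finset_le _ _
      _ ≤ ∑ f ∈ S, ENNReal.ofReal (Real.exp (-s) ^ m) := by
          refine Finset.sum_le_sum fun f hf => ?_
          have hinj : Function.Injective fun l => (f l : ℕ) :=
            Fin.val_injective.comp (Finset.mem_filter.1 hf).2
          rw [(hX_indep.precomp hinj).measure_inter_preimage_eq_mul Finset.univ
            (sets := fun l => {v | ∀ j, y l j < v j}) fun l _ => measurableSet_forall_lt (y l)]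
          calc _ ≤ ∏ l : Fin m, ENNReal.ofReal (Real.exp (-s)) := by
                refine Finset.prod_le_prod' fun l _ => ?_
                rw [Set.preimage_ofPred_eq, measure_forall_lt hX_meas hX_coord hX_exp _ (hy l)]
                have := hs l
                gcongr
            _ = _ := by
                rw [Finset.prod_const, Finset.card_univ, Fintype.card_fin,
                  ENNReal.ofReal_pow (Real.exp_pos _).le]
      _ = ENNReal.ofReal (S.card * Real.exp (-s) ^ m) := by
          rw [Finset.sum_const, nsmul_eq_mul, ENNReal.ofReal_mul (Nat.cast_nonneg _),
            ENNReal.ofReal_natCast]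
      _ ≤ _ := by
          rw [mul_pow]
          gcongr
  rw [ENNReal.ofReal_add (by positivity) (by positivity)]
  exact (measure_mono hsub).trans ((measure_union_le _ _).trans (add_le_add hT hS))

end

/-! ### Reduction to dyadic times and Borel–Cantelli -/

theorem tendsto_natLog_two_atTop : Tendsto (Nat.log 2) atTop atTop :=
  tendsto_atTop.2 fun k => (eventually_ge_atTop (2 ^ k)).mono fun _ hn =>
    Nat.le_log_of_pow_le one_lt_two hn

section

variable {Ω : Type*} [MeasurableSpace Ω] {P : Measure Ω} {A G : ℕ → Set Ω}

theorem tendsto_measure_of_ae_le_dyadic (hG : ∑' k, P (G k) ≠ ⊤)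
    (hA : ∀ᶠ n in atTop, A n ≤ᵐ[P] G (Nat.log 2 n)) :
    Tendsto (fun n => P (A n)) atTop (𝓝 0) := by
  have h := (ENNReal.tendsto_atTop_zero_of_tsum_ne_top hG).comp tendsto_natLog_two_atTop
  refine tendsto_of_tendsto_of_tendsto_of_le_of_le' tendsto_const_nhds h
    (Eventually.of_forall fun _ => zero_le) ?_
  exact hA.mono fun n hn => measure_mono_ae hn

theorem measure_frequently_eq_zero_of_ae_le_dyadic (hG : ∑' k, P (G k) ≠ ⊤)
    (hA : ∀ᶠ n in atTop, A n ≤ᵐ[P] G (Nat.log 2 n)) :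
    P {ω | ∃ᶠ n in atTop, ω ∈ A n} = 0 := by
  obtain ⟨N, hN⟩ := eventually_atTop.1 hA
  have hN' : ∀ᵐ ω ∂P, ∀ n, N ≤ n → ω ∈ A n → ω ∈ G (Nat.log 2 n) :=
    ae_all_iff.2 fun n => by
      by_cases hn : N ≤ n
      · filter_upwards [hN n hn] with ω hω _ using hω
      · exact ae_of_all _ fun ω h => absurd h hn
  have : ∀ᵐ ω ∂P, ¬ ∃ᶠ n in atTop, ω ∈ A n := by
    filter_upwards [hN', ae_eventually_notMem hG] with ω h1 h2
    rw [not_frequently]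
    filter_upwards [tendsto_natLog_two_atTop.eventually h2, eventually_ge_atTop N] with n hn hNn h
    exact hn (h1 n hNn h)
  simpa only [ae_iff, not_not] using this

theorem tsum_measure_ne_top_of_le_ofReal {g : ℕ → ℝ} (hg : Summable g)
    [IsFiniteMeasure P] (h : ∀ᶠ k in atTop, P (G k) ≤ ENNReal.ofReal (g k)) :
    ∑' k, P (G k) ≠ ⊤ := by
  obtain ⟨N, hN⟩ := eventually_atTop.1 h
  rw [← ENNReal.summable.sum_add_tsum_nat_add' (k := N)]
  refine ENNReal.add_ne_top.2 ⟨ENNReal.sum_ne_top.2 fun _ _ => measure_ne_top _ _, ?_⟩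
  exact ne_top_of_le_ne_top ((summable_nat_add_iff N).2 hg).tsum_ofReal_ne_top
    (ENNReal.tsum_le_tsum fun k => hN (k + N) (Nat.le_add_left _ _))

end

/-! ### Logarithmic estimates -/

theorem tendsto_log_natCast_atTop : Tendsto (fun n : ℕ => Real.log n) atTop atTop :=
  Real.tendsto_log_atTop.comp tendsto_natCast_atTop_atTop

theorem tendsto_log_log_natCast_atTop :
    Tendsto (fun n : ℕ => Real.log (Real.log n)) atTop atTop :=
  Real.tendsto_log_atTop.comp tendsto_log_natCast_atTop

theorem log_two_pow_log_le {n : ℕ} (hn : n ≠ 0) :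
    Nat.log 2 n * Real.log 2 ≤ Real.log n := by
  rw [← Real.log_pow]
  have : (2 : ℝ) ^ Nat.log 2 n ≤ n := by exact_mod_cast Nat.pow_log_le_self 2 hn
  exact Real.log_le_log (by positivity) this

theorem log_lt_log_two_pow_log_succ {n : ℕ} (hn : n ≠ 0) :
    Real.log n < (Nat.log 2 n + 1) * Real.log 2 := by
  have h : Real.log n < Real.log (2 ^ (Nat.log 2 n + 1)) := by
    have : (n : ℝ) < 2 ^ (Nat.log 2 n + 1) := by
      exact_mod_cast Nat.lt_pow_succ_log_self one_lt_two n
    exact Real.log_lt_log (by positivity) this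
  rwa [Real.log_pow, Nat.cast_add, Nat.cast_one] at h

theorem tendsto_natCast_mul_log_two_atTop :
    Tendsto (fun k : ℕ => k * Real.log 2) atTop atTop :=
  tendsto_natCast_atTop_atTop.atTop_mul_const (Real.log_pos one_lt_two)

theorem summable_const_div_mul_log_two_sq (C : ℝ) :
    Summable fun k : ℕ => C / (k * Real.log 2) ^ 2 := by
  have h := (Real.summable_one_div_nat_pow.2 one_lt_two).mul_left (C / Real.log 2 ^ 2)
  refine h.congr fun k => ?_
  rw [mul_pow, div_mul_div_comm, mul_one, mul_comm (Real.log 2 ^ 2)]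

/-- The exponential decay beats any power of `u`. -/
theorem eventually_pow_mul_exp_neg_log_pow_three_le (d : ℕ) {c : ℝ} (hc : 0 < c) :
    ∀ᶠ u : ℝ in atTop, u ^ d * Real.exp (-(c * Real.log u ^ 3)) ≤ 1 / u ^ 2 := by
  have h : ∀ᶠ L : ℝ in atTop, (d + 2) ≤ c * L ^ 2 :=
    ((tendsto_pow_atTop two_ne_zero).const_mul_atTop hc).eventually_ge_atTop _
  filter_upwards [Real.tendsto_log_atTop.eventually h, eventually_gt_atTop 1] with u hu hu1
  have hL : 0 < Real.log u := Real.log_pos hu1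
  have hu0 : 0 < u := by linarith
  have h1 : Real.exp (-(c * Real.log u ^ 3)) ≤ Real.exp (-((d + 2) * Real.log u)) := by
    refine Real.exp_le_exp.2 (neg_le_neg ?_)
    calc (d + 2) * Real.log u ≤ c * Real.log u ^ 2 * Real.log u := by gcongr
      _ = _ := by ring
  have h2 : Real.exp (-((d + 2) * Real.log u)) = (u ^ (d + 2))⁻¹ := by
    rw [Real.exp_neg, ← Real.exp_log (pow_pos hu0 (d + 2)), Real.log_pow]
    push_cast
    rfl
  calc _ ≤ u ^ d * (u ^ (d + 2))⁻¹ := by rw [← h2]; gcongr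
    _ = 1 / u ^ 2 := by rw [pow_add]; field_simp

/-! ### Summable dyadic bounds for both deviations, and the one-point upper bound -/

section

variable {d : ℕ} {Ω : Type*} [MeasurableSpace Ω] {P : Measure Ω}
  {X : ℕ → Ω → Fin d → ℝ}

theorem tsum_measure_exists_mem_recordRegion_ne_top [IsProbabilityMeasure P]
    (hX_meas : ∀ i, Measurable (X i))
    (hX_indep : iIndepFun X P)
    (hX_coord : ∀ i, iIndepFun (fun (j : Fin d) (ω : Ω) => X i ω j) P)
    (hX_exp : ∀ i j, P.map (fun ω => X i ω j) = expMeasure 1) :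
    ∑' k : ℕ, P {ω | ∃ y ∈ recordRegion (fun i => X i ω) (2 ^ k),
      ∑ j, y j ≤ (k + 1) * Real.log 2 - 3 * Real.log (Real.log (k * Real.log 2))} ≠ ⊤ := by
  refine tsum_measure_ne_top_of_le_ofReal (summable_const_div_mul_log_two_sq (6 ^ d)) ?_
  have h := eventually_pow_mul_exp_neg_log_pow_three_le d
    (c := Real.exp (-(Real.log 2 + d))) (Real.exp_pos _)
  have hl := tendsto_natCast_mul_log_two_atTop
  have hll := Real.tendsto_log_atTop.comp hl
  filter_upwards [hl.eventually h, hll.eventually_gt_atTop 1, eventually_ge_atTop 2]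
    with k hk hk1 hk2
  simp only [Function.comp_apply] at hk1
  have hk2' : (2 : ℝ) ≤ k := by exact_mod_cast hk2
  have hlog2 : Real.log 2 ≤ 1 := by
    have := Real.log_two_lt_d9; linarith
  have hlog2' : 1 / 2 ≤ Real.log 2 := by
    have := Real.log_two_gt_d9; linarith
  have hlll : 0 < Real.log (Real.log (k * Real.log 2)) := Real.log_pos hk1
  refine (measure_exists_mem_recordRegion_sum_le hX_meas hX_indep hX_coord hX_exp (2 ^ k) (k + 1)
    ?_).trans (ENNReal.ofReal_le_ofReal ?_)
  · push_cast
    nlinarith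
  · have hexp : ((2 ^ k : ℕ) : ℝ) * Real.exp (-((k + 1) * Real.log 2
        - 3 * Real.log (Real.log (k * Real.log 2)) + d))
        = Real.exp (-(Real.log 2 + d)) * Real.log (k * Real.log 2) ^ 3 := by
      have e1 : ((2 ^ k : ℕ) : ℝ) = Real.exp (k * Real.log 2) := by
        rw [Real.exp_nat_mul, Real.exp_log two_pos]
        push_cast
        rfl
      have e2 : Real.log (k * Real.log 2) ^ 3
          = Real.exp (3 * Real.log (Real.log (k * Real.log 2))) := by
        rw [show (3 : ℝ) = (3 : ℕ) by norm_num, Real.exp_nat_mul, Real.exp_log (by linarith)]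
      rw [e1, e2, ← Real.exp_add, ← Real.exp_add]
      ring_nf
    rw [hexp]
    -- The grid has k + 2 values per coordinate, and k + 2 ≤ 3k ≤ 6 k log 2.
    calc _ ≤ (6 * (k * Real.log 2)) ^ d
          * Real.exp (-(Real.exp (-(Real.log 2 + d)) * Real.log (k * Real.log 2) ^ 3)) := by
          gcongr
          push_cast
          nlinarith
      _ = 6 ^ d * ((k * Real.log 2) ^ d
          * Real.exp (-(Real.exp (-(Real.log 2 + d)) * Real.log (k * Real.log 2) ^ 3))) := by
          rw [mul_pow, mul_assoc]
      _ ≤ 6 ^ d * (1 / (k * Real.log 2) ^ 2) := by gcongr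
      _ = _ := by ring

/-- For 2^k ≤ n < 2^(k+1), the minimum at time 2^k is no larger than at n, while the threshold is
relaxed to one depending on k alone. -/
theorem eventually_frontierMin_le_ae_le_dyadic (hd : 1 ≤ d)
    (hpos : ∀ᵐ ω ∂P, ∀ i j, 0 < X i ω j) :
    ∀ᶠ n : ℕ in atTop, ({ω | frontierMin (fun i => X i ω) n
        ≤ Real.log n - 3 * Real.log (Real.log (Real.log n))} : Set Ω)
      ≤ᵐ[P] (fun k : ℕ => {ω | ∃ y ∈ recordRegion (fun i => X i ω) (2 ^ k),
        ∑ j, y j ≤ (k + 1) * Real.log 2 - 3 * Real.log (Real.log (k * Real.log 2))})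
        (Nat.log 2 n) := by
  have hl := tendsto_natCast_mul_log_two_atTop.comp tendsto_natLog_two_atTop
  have hll := Real.tendsto_log_atTop.comp hl
  filter_upwards [hl.eventually_gt_atTop 0, hll.eventually_gt_atTop 0, eventually_ne_atTop 0]
    with n h0 h1 hn
  simp only [Function.comp_apply] at h0 h1
  filter_upwards [hpos] with ω hω hF
  have hx : ∃ i < 2 ^ Nat.log 2 n, ∀ j, 0 < X i ω j := ⟨0, by positivity, hω 0⟩
  refine (frontierMin_le_iff hd hx).1 ?_
  refine (frontierMin_mono hd hx (Nat.pow_log_le_self 2 hn)).trans (le_trans hF ?_)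
  have a1 := log_two_pow_log_le hn
  have a2 := log_lt_log_two_pow_log_succ hn
  have a3 := Real.log_le_log h1 (Real.log_le_log h0 a1)
  linarith

theorem tsum_measure_forall_exists_lt_ne_top [IsProbabilityMeasure P]
    (hd : 2 ≤ d) (hX_meas : ∀ i, Measurable (X i))
    (hX_indep : iIndepFun X P)
    (hX_coord : ∀ i, iIndepFun (fun (j : Fin d) (ω : Ω) => X i ω j) P)
    (hX_exp : ∀ i j, P.map (fun ω => X i ω j) = expMeasure 1) {c : ℝ} (hc : 0 < c) :
    ∑' k : ℕ, P {ω | ∀ y : Fin d → ℝ, 0 ≤ y →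
      ∑ j, y j = k * Real.log 2 + c * Real.log (k * Real.log 2) - 1 →
      ∃ i < 2 ^ (k + 1), ∀ j, y j < X i ω j} ≠ ⊤ := by
  -- Since n e^{-s} is of order u^{-c}, taking c m ≥ 2 makes its m-th power O(u^{-2}); the gap δ = 2
  -- log u below gives the same order for shared observations.
  obtain ⟨m, hm⟩ := exists_nat_ge (2 / c)
  have hcm : 2 ≤ c * m := by rwa [div_le_iff₀' hc] at hm
  refine tsum_measure_ne_top_of_le_ofReal (summable_const_div_mul_log_two_sq
    (m ^ 2 * Real.exp (1 + Real.log 2) + Real.exp (1 + Real.log 2) ^ m)) ?_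
  have hl := tendsto_natCast_mul_log_two_atTop
  have hll := Real.tendsto_log_atTop.comp hl
  have hsmall : ∀ᶠ u : ℝ in atTop, Real.log u ≤ (1 / (4 * m + 4)) * u := by
    have := Real.isLittleO_log_id_atTop.bound (c := 1 / (4 * m + 4)) (by positivity)
    filter_upwards [this, eventually_ge_atTop 0] with u hu hu0
    simp only [id, Real.norm_eq_abs, abs_of_nonneg hu0] at hu
    exact (le_abs_self _).trans hu
  filter_upwards [hl.eventually hsmall, hll.eventually_gt_atTop 0, hl.eventually_ge_atTop 2]
    with k hk1 hk2 hk3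
  simp only [Function.comp_apply] at hk2
  set u := k * Real.log 2 with hu
  set s := u + c * Real.log u - 1 with hs
  set δ := 2 * Real.log u with hδ
  have hu0 : 0 < u := by linarith
  have hδ0 : 0 ≤ δ := by positivity
  -- This keeps all m points in the orthant.
  have hmδ : m * δ ≤ s := by
    have h1 : (4 * m + 4) * Real.log u ≤ u := by
      rwa [one_div, inv_mul_eq_div, le_div_iff₀' (by positivity)] at hk1
    have : 0 < c * Real.log u := by positivity
    nlinarith
  let a : Fin d := ⟨0, by lia⟩
  let b : Fin d := ⟨1, by lia⟩
  have hab : a ≠ b := by simp [a, b]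
  -- The points trade off two coordinates along a segment of constant sum s, which needs d ≥ 2. The
  -- join of the l-th and l'-th points has sum s + |l - l'| δ.
  let y : Fin m → Fin d → ℝ := fun l => Pi.single a (l * δ) + Pi.single b (s - l * δ)
  have hlδ : ∀ l : Fin m, l * δ ≤ s := fun l => by
    have : (l : ℝ) ≤ m := by exact_mod_cast l.2.le
    exact le_trans (by gcongr) hmδ
  have hy : ∀ l, 0 ≤ y l := fun l =>
    add_nonneg (Pi.single_nonneg.2 (by positivity)) (Pi.single_nonneg.2 (by linarith [hlδ l]))
  have hys : ∀ l, ∑ j, y l j = s := fun l => by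
    simp [y, Finset.sum_add_distrib]
  have hsup : ∀ l l' : Fin m, l < l' → s + δ ≤ ∑ j, (y l ⊔ y l') j := fun l l' hll' => by
    have hle : Pi.single a (l' * δ) + Pi.single b (s - l * δ) ≤ y l ⊔ y l' := fun j => by
      by_cases hja : j = a
      · subst hja
        simp [y, hab]
      · by_cases hjb : j = b
        · subst hjb
          simp [y, hja]
        · simp [y, hja, hjb]
    refine le_trans ?_ (Finset.sum_le_sum fun j _ => hle j)
    have : (l : ℝ) + 1 ≤ l' := by exact_mod_cast hll'
    simp only [Pi.add_apply, Finset.sum_add_distrib, Finset.sum_pi_single', Finset.mem_univ,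
      if_true]
    nlinarith
  have hsup' : ∀ l l' : Fin m, l ≠ l' → s + δ ≤ ∑ j, (y l ⊔ y l') j := fun l l' hne => by
    rcases hne.lt_or_gt with h | h
    · exact hsup l l' h
    · rw [sup_comm]
      exact hsup l' l h
  have hsub : {ω | ∀ y : Fin d → ℝ, 0 ≤ y → ∑ j, y j = s →
      ∃ i < 2 ^ (k + 1), ∀ j, y j < X i ω j}
      ⊆ {ω | ∀ l, ∃ i < 2 ^ (k + 1), ∀ j, y l j < X i ω j} :=
    fun ω hω l => hω (y l) (hy l) (hys l)
  refine (measure_mono hsub).trans ((measure_forall_exists_forall_lt_le hX_meas hX_indep hX_coord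
    hX_exp (2 ^ (k + 1)) m hy (fun l => (hys l).ge) hsup').trans (ENNReal.ofReal_le_ofReal ?_))
  have e0 : ((2 ^ (k + 1) : ℕ) : ℝ) = Real.exp (Real.log 2 + u) := by
    rw [Real.exp_add, hu, Real.exp_nat_mul, Real.exp_log two_pos]
    push_cast
    ring
  have hL : 0 < Real.log u := hk2
  have e1 : ((2 ^ (k + 1) : ℕ) : ℝ) * Real.exp (-(s + δ))
      ≤ Real.exp (1 + Real.log 2) * (1 / u ^ 2) := by
    have : 1 / u ^ 2 = Real.exp (-(2 * Real.log u)) := by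
      rw [Real.exp_neg, show (2 : ℝ) = (2 : ℕ) by norm_num, Real.exp_nat_mul, Real.exp_log hu0,
        one_div]
    rw [e0, this, ← Real.exp_add, ← Real.exp_add]
    refine Real.exp_le_exp.2 ?_
    have : 0 < c * Real.log u := by positivity
    linarith
  have e2 : (((2 ^ (k + 1) : ℕ) : ℝ) * Real.exp (-s)) ^ m
      ≤ Real.exp (1 + Real.log 2) ^ m * (1 / u ^ 2) := by
    have : 1 / u ^ 2 = Real.exp (-(2 * Real.log u)) := by
      rw [Real.exp_neg, show (2 : ℝ) = (2 : ℕ) by norm_num, Real.exp_nat_mul, Real.exp_log hu0,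
        one_div]
    rw [e0, this, ← Real.exp_add, ← Real.exp_nat_mul, ← Real.exp_nat_mul, ← Real.exp_add]
    refine Real.exp_le_exp.2 ?_
    have : 2 * Real.log u ≤ c * m * Real.log u := by gcongr
    rw [hs]
    nlinarith
  calc _ ≤ m ^ 2 * (Real.exp (1 + Real.log 2) * (1 / u ^ 2))
        + Real.exp (1 + Real.log 2) ^ m * (1 / u ^ 2) := by gcongr
    _ = _ := by ring

theorem eventually_le_frontierMin_ae_le_dyadic (hd : 1 ≤ d)
    (hpos : ∀ᵐ ω ∂P, ∀ i j, 0 < X i ω j) {c : ℝ} (hc : 0 < c) :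
    ∀ᶠ n : ℕ in atTop, ({ω | Real.log n + c * Real.log (Real.log n)
        ≤ frontierMin (fun i => X i ω) n} : Set Ω)
      ≤ᵐ[P] (fun k : ℕ => {ω | ∀ y : Fin d → ℝ, 0 ≤ y →
        ∑ j, y j = k * Real.log 2 + c * Real.log (k * Real.log 2) - 1 →
        ∃ i < 2 ^ (k + 1), ∀ j, y j < X i ω j}) (Nat.log 2 n) := by
  have hl := tendsto_natCast_mul_log_two_atTop.comp tendsto_natLog_two_atTop
  filter_upwards [hl.eventually_gt_atTop 0, eventually_ne_atTop 0] with n h0 hn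
  simp only [Function.comp_apply] at h0
  filter_upwards [hpos] with ω hω hF y hy hys
  have hx : ∃ i < n, ∀ j, 0 < X i ω j := ⟨0, by positivity, hω 0⟩
  have hmono := frontierMin_mono hd hx (Nat.lt_pow_succ_log_self one_lt_two n).le
  refine exists_forall_lt_of_sum_lt_frontierMin hd ⟨0, by positivity, hω 0⟩ hy ?_
  -- The `- 1` in the prescribed sum supplies the strict inequality.
  refine lt_of_lt_of_le ?_ (le_trans hF hmono)
  rw [hys]
  have a1 := log_two_pow_log_le hn
  have a3 := mul_le_mul_of_nonneg_left (Real.log_le_log h0 a1) hc.le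
  linarith

theorem tendsto_measure_le_frontierMin [IsProbabilityMeasure P]
    (hd : 1 ≤ d) (hX_meas : ∀ i, Measurable (X i))
    (hX_coord : ∀ i, iIndepFun (fun (j : Fin d) (ω : Ω) => X i ω j) P)
    (hX_exp : ∀ i j, P.map (fun ω => X i ω j) = expMeasure 1)
    {c : ℕ → ℝ} (hc : Tendsto c atTop atTop) :
    Tendsto (fun n : ℕ => P {ω | Real.log n + c n ≤ frontierMin (fun i => X i ω) n})
      atTop (𝓝 0) := by
  have hpos := ae_forall_coord_pos hX_meas hX_exp
  have hlim : Tendsto (fun n => ENNReal.ofReal (Real.exp (-(c n - 1)))) atTop (𝓝 0) := by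
    rw [← ENNReal.ofReal_zero]
    refine ENNReal.tendsto_ofReal (Real.tendsto_exp_neg_atTop_nhds_zero.comp ?_)
    exact tendsto_atTop_add_const_right _ _ hc
  refine tendsto_of_tendsto_of_tendsto_of_le_of_le' tendsto_const_nhds hlim
    (Eventually.of_forall fun _ => zero_le) ?_
  filter_upwards [hc.eventually_ge_atTop 1, eventually_ne_atTop 0] with n hcn hn
  have hn' : (0 : ℝ) < n := by positivity
  have hlog : 0 ≤ Real.log n := Real.log_natCast_nonneg n
  let y : Fin d → ℝ := Pi.single ⟨0, hd⟩ (Real.log n + (c n - 1))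
  have hy : 0 ≤ y := Pi.single_nonneg.2 (by linarith)
  have hys : ∑ j, y j = Real.log n + (c n - 1) := by simp [y]
  have hsub : ({ω | Real.log n + c n ≤ frontierMin (fun i => X i ω) n} : Set Ω)
      ≤ᵐ[P] {ω | ∃ i < n, ∀ j, y j < X i ω j} := by
    filter_upwards [hpos] with ω hω hF
    refine exists_forall_lt_of_sum_lt_frontierMin hd ⟨0, by positivity, hω 0⟩ hy ?_
    rw [hys]
    exact lt_of_lt_of_le (by linarith) hF
  refine (measure_mono_ae hsub).trans
    ((measure_exists_forall_lt_le hX_meas hX_coord hX_exp n hy).trans (le_of_eq ?_))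
  rw [hys, neg_add, Real.exp_add, Real.exp_neg, Real.exp_log hn', mul_inv_cancel_left₀ hn'.ne']

end

/-! ### Low running maxima of one coordinate infinitely often -/

theorem iIndepSet_biInter_Ico_preimage {Ω β : Type*} [MeasurableSpace Ω] [MeasurableSpace β]
    {P : Measure Ω} {Y : ℕ → Ω → β} (hY_meas : ∀ i, Measurable (Y i)) (hY : iIndepFun Y P)
    {N : ℕ → ℕ} (hN : Monotone N) {S : ℕ → Set β} (hS : ∀ k, MeasurableSet (S k)) :
    iIndepSet (fun k => ⋂ i ∈ Finset.Ico (N k) (N (k + 1)), Y i ⁻¹' S k) P := by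
  classical
  have hdisj : ∀ k k' i, i ∈ Finset.Ico (N k) (N (k + 1)) → i ∈ Finset.Ico (N k') (N (k' + 1)) →
      ¬ k < k' := fun k k' i hk hk' hlt => by
    have := hN (Nat.succ_le_of_lt hlt)
    simp only [Finset.mem_Ico, Nat.succ_eq_add_one] at *
    lia
  have huniq : ∀ k k' i, i ∈ Finset.Ico (N k) (N (k + 1)) →
      i ∈ Finset.Ico (N k') (N (k' + 1)) → k = k' := fun k k' i hk hk' =>
    le_antisymm (not_lt.1 (hdisj k' k i hk' hk)) (not_lt.1 (hdisj k k' i hk hk'))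
  -- The block containing i; the default 0 is never used. Indexing the sets by i alone lets one
  -- product formula cover a union of blocks.
  let κ : ℕ → ℕ := fun i =>
    if h : ∃ k, i ∈ Finset.Ico (N k) (N (k + 1)) then h.choose else 0
  have hκ : ∀ k i, i ∈ Finset.Ico (N k) (N (k + 1)) → κ i = k := fun k i hi => by
    have h : ∃ k, i ∈ Finset.Ico (N k) (N (k + 1)) := ⟨k, hi⟩
    simp only [κ, dif_pos h]
    exact huniq _ _ i h.choose_spec hi
  have hblock : ∀ k, (⋂ i ∈ Finset.Ico (N k) (N (k + 1)), Y i ⁻¹' S k)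
      = ⋂ i ∈ Finset.Ico (N k) (N (k + 1)), Y i ⁻¹' S (κ i) := fun k =>
    Set.iInter₂_congr fun i hi => by rw [hκ k i hi]
  rw [iIndepSet_iff_meas_biInter fun k =>
    Finset.measurableSet_biInter _ fun i _ => hY_meas i (hS k)]
  intro s
  simp_rw [hblock]
  rw [← Finset.set_biInter_biUnion,
    hY.measure_inter_preimage_eq_mul _ fun i _ => hS (κ i), Finset.prod_biUnion]
  · exact Finset.prod_congr rfl fun k _ =>
      (hY.measure_inter_preimage_eq_mul _ fun i _ => hS (κ i)).symm
  · intro k _ k' _ hne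
    exact Finset.disjoint_left.2 fun i hi hi' => hne (huniq k k' i hi hi')

/-- By Cauchy condensation the series becomes that of 1/(1 + k log 2), which dominates the harmonic
series. -/
theorem not_summable_one_div_mul_one_add_log :
    ¬ Summable fun k : ℕ => 1 / (k * (1 + Real.log k)) := by
  have hnn : ∀ k : ℕ, 0 ≤ 1 / (k * (1 + Real.log k)) := fun k => by
    have := Real.log_natCast_nonneg k
    positivity
  rw [← summable_condensed_iff_of_nonneg hnn fun m n hm hmn => by
    have h1 : (m : ℝ) ≤ n := by exact_mod_cast hmn
    have h2 := Real.log_natCast_nonneg m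
    have h3 : (0 : ℝ) < m := by exact_mod_cast hm
    gcongr]
  intro h
  refine Real.not_summable_one_div_natCast ((summable_nat_add_iff 1).1 ?_)
  refine Summable.of_nonneg_of_le (fun k => by positivity) (fun k => ?_) h
  have hlog2 : Real.log 2 ≤ 1 := by
    have := Real.log_two_lt_d9; linarith
  have hlog2' : 0 < Real.log 2 := Real.log_pos one_lt_two
  push_cast
  rw [Real.log_pow, mul_one_div, div_mul_cancel_left₀ (by positivity), ← one_div]
  have : (k : ℝ) * Real.log 2 ≤ k := mul_le_of_le_one_right (by positivity) hlog2
  refine one_div_le_one_div_of_le (by positivity) (by linarith)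

theorem tsum_eq_top_of_eventually_ofReal_le {f : ℕ → ℝ} (hf0 : ∀ k, 0 ≤ f k)
    (hf : ¬ Summable f) {a : ℕ → ENNReal} (h : ∀ᶠ k in atTop, ENNReal.ofReal (f k) ≤ a k) :
    ∑' k, a k = ⊤ := by
  by_contra hne
  refine hf ((ENNReal.summable_toReal hne).of_norm_bounded_eventually_nat ?_)
  filter_upwards [h] with k hk
  rw [Real.norm_of_nonneg (hf0 k)]
  exact (ENNReal.ofReal_le_iff_le_toReal (ENNReal.ne_top_of_tsum_ne_top hne k)).1 hk

/-- From log x ≥ 1 - 1/x, the exponent is at least -(l + l²/(n - l)), and l² ≤ n ≤ 2(n - l) bounds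
the error by 2. -/
theorem exp_neg_add_two_le_one_sub_div_pow {n : ℕ} {l : ℝ} (hn : 0 < n) (hl : 2 * l ≤ n)
    (hl2 : l ^ 2 ≤ n) : Real.exp (-(l + 2)) ≤ (1 - l / n) ^ n := by
  have hn' : (0 : ℝ) < n := by exact_mod_cast hn
  have hpos : 0 < (n : ℝ) - l := by linarith
  have h1 : 0 < 1 - l / n := by
    rw [sub_pos, div_lt_one hn']
    linarith
  rw [← Real.exp_log h1, ← Real.exp_nat_mul]
  refine Real.exp_le_exp.2 ?_
  have h2 := mul_le_mul_of_nonneg_left (Real.one_sub_inv_le_log_of_pos h1) hn'.le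
  refine le_trans ?_ h2
  have h3 : (n : ℝ) * (1 - (1 - l / n)⁻¹) = -(l + l ^ 2 / (n - l)) := by
    have h4 : 1 - l / n = (n - l) / n := by field_simp
    rw [h4]
    field_simp
    ring
  have h4 : l ^ 2 / (n - l) ≤ 2 := by
    rw [div_le_iff₀ hpos]
    linarith
  rw [h3]
  linarith

theorem log_factorial_sq_le (k : ℕ) :
    Real.log ((k.factorial ^ 2 : ℕ) : ℝ) ≤ 2 * (k * Real.log k) := by
  have : (k.factorial : ℝ) ≤ k ^ k := by exact_mod_cast Nat.factorial_le_pow k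
  have h := Real.log_le_log (by positivity) this
  rw [Real.log_pow] at h
  push_cast
  rw [Real.log_pow]
  push_cast
  linarith

theorem tendsto_factorial_sq_atTop : Tendsto (fun k : ℕ => k.factorial ^ 2) atTop atTop :=
  tendsto_atTop_mono (fun k => k.self_le_factorial.trans (Nat.le_self_pow two_ne_zero _)) tendsto_id

theorem log_log_factorial_sq_le {k : ℕ}
    (hl : 0 < Real.log ((k.factorial ^ 2 : ℕ) : ℝ)) (hk1 : 1 ≤ k) :
    Real.log (Real.log ((k.factorial ^ 2 : ℕ) : ℝ)) ≤ 5 * (k : ℝ) ^ (1 / 2 : ℝ) := by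
  have hk0 : (1 : ℝ) ≤ k := by exact_mod_cast hk1
  have h1 : Real.log ((k.factorial ^ 2 : ℕ) : ℝ) ≤ 2 * (k : ℝ) ^ 2 := by
    have := Real.log_le_self (zero_le_one.trans hk0)
    have := log_factorial_sq_le k
    nlinarith
  have h2 := Real.log_le_log hl h1
  rw [Real.log_mul two_ne_zero (by positivity), Real.log_pow] at h2
  have h3 := Real.log_le_rpow_div (zero_le_one.trans hk0) (ε := 1 / 2) (by norm_num)
  have h4 := Real.log_two_lt_d9
  have h5 : 1 ≤ (k : ℝ) ^ (1 / 2 : ℝ) := Real.one_le_rpow hk0 (by norm_num)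
  rw [Nat.cast_ofNat] at h2
  linarith

section

variable {d : ℕ} {Ω : Type*} [MeasurableSpace Ω] {P : Measure Ω}
  {X : ℕ → Ω → Fin d → ℝ}

theorem ae_frequently_forall_lt_coord_le [IsProbabilityMeasure P]
    (hX_meas : ∀ i, Measurable (X i))
    (hX_indep : iIndepFun X P)
    (hX_exp : ∀ i j, P.map (fun ω => X i ω j) = expMeasure 1) (j : Fin d) :
    ∀ᵐ ω ∂P, ∃ᶠ n : ℕ in atTop, ∀ i < n,
      X i ω j ≤ Real.log n - Real.log (Real.log (Real.log n)) := by
  -- The ratio (k+1)² makes the earlier observations negligible: `C` has probability O(k^{-3/2}).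
  -- Yet log N grows only like k log k, so P(`B` k), at least a constant over log N (k+1), has
  -- divergent sum. With k! alone the bound for `C` would not be summable.
  let N : ℕ → ℕ := fun k => k.factorial ^ 2
  let u : ℕ → ℝ := fun n => Real.log n - Real.log (Real.log (Real.log n))
  let Y : ℕ → Ω → ℝ := fun i ω => X i ω j
  have hY_meas : ∀ i, Measurable (Y i) := fun i => (measurable_pi_apply j).comp (hX_meas i)
  have hY : iIndepFun Y P := hX_indep.comp (fun _ v => v j) fun _ => measurable_pi_apply j
  have hNmono : Monotone N := fun a b hab =>
    Nat.pow_le_pow_left (Nat.factorial_le hab) 2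
  have hN : Tendsto (fun k => N (k + 1)) atTop atTop :=
    tendsto_factorial_sq_atTop.comp (tendsto_add_atTop_nat 1)
  let B : ℕ → Set Ω := fun k => ⋂ i ∈ Finset.Ico (N k) (N (k + 1)), Y i ⁻¹' Set.Iic (u (N (k + 1)))
  let C : ℕ → Set Ω := fun k => ⋃ i ∈ Finset.range (N k), {ω | u (N (k + 1)) < Y i ω}
  have hlarge : ∀ᶠ n : ℕ in atTop, 0 < Real.log n ∧ 0 < Real.log (Real.log n) ∧
      2 * Real.log (Real.log n) ≤ n ∧ Real.log (Real.log n) ^ 2 ≤ n := by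
    have hsq : ∀ᶠ x : ℝ in atTop, Real.log x ^ 2 ≤ x := by
      have := (Real.isLittleO_pow_log_id_atTop (n := 2)).bound one_pos
      filter_upwards [this, eventually_ge_atTop 0] with x hx hx0
      simpa [abs_of_nonneg hx0] using hx
    filter_upwards [tendsto_log_natCast_atTop.eventually_gt_atTop 0,
      tendsto_log_log_natCast_atTop.eventually_ge_atTop 2,
      tendsto_log_natCast_atTop.eventually hsq] with n h1 h2 h3
    have h4 : Real.log n ≤ n := Real.log_le_self (Nat.cast_nonneg n)
    exact ⟨h1, by linarith, by nlinarith, by linarith⟩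
  have htail : ∀ n : ℕ, 0 < Real.log (n : ℝ) → 0 < Real.log (Real.log n) →
      2 * Real.log (Real.log n) ≤ n →
      ∀ i, P {ω | u n < Y i ω} = ENNReal.ofReal (Real.log (Real.log n) / n) := by
    intro n h1 h2 h3 i
    have hn : (0 : ℝ) < n := by linarith
    have hu : 0 ≤ u n := sub_nonneg.2 (Real.log_le_log h2 (by linarith))
    rw [measure_lt_coord hX_meas hX_exp i j hu, neg_sub, Real.exp_sub, Real.exp_log h2,
      Real.exp_log hn]
  have hC : ∑' k, P (C k) ≠ ⊤ := by
    have hsum : Summable fun k : ℕ => 5 * (1 / ((k + 1 : ℕ) : ℝ) ^ (3 / 2 : ℝ)) :=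
      ((summable_nat_add_iff 1).2
        (Real.summable_one_div_nat_rpow.2 (by norm_num : (1 : ℝ) < 3 / 2))).mul_left 5
    refine tsum_measure_ne_top_of_le_ofReal hsum ?_
    filter_upwards [hN.eventually hlarge] with k ⟨h1, h2, h3, _⟩
    refine (measure_biUnion_finset_le _ _).trans ?_
    simp_rw [htail _ h1 h2 h3]
    rw [Finset.sum_const, Finset.card_range, nsmul_eq_mul, ← ENNReal.ofReal_natCast (N k),
      ← ENNReal.ofReal_mul (Nat.cast_nonneg _)]
    refine ENNReal.ofReal_le_ofReal ?_
    have hNk : (N (k + 1) : ℝ) = ((k + 1 : ℕ) : ℝ) ^ 2 * N k := by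
      simp only [N, Nat.factorial_succ]
      push_cast
      ring
    have hNpos : (0 : ℝ) < N k := by
      simp only [N]
      positivity
    have hkpos : (0 : ℝ) < (k + 1 : ℕ) := by positivity
    have hle := log_log_factorial_sq_le (k := k + 1) h1 (by lia)
    calc (N k : ℝ) * (Real.log (Real.log (N (k + 1))) / N (k + 1))
        = Real.log (Real.log (N (k + 1))) / ((k + 1 : ℕ) : ℝ) ^ 2 := by
          rw [hNk]
          field_simp
      _ ≤ 5 * ((k + 1 : ℕ) : ℝ) ^ (1 / 2 : ℝ) / ((k + 1 : ℕ) : ℝ) ^ 2 := by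
          gcongr
      _ = 5 * (1 / ((k + 1 : ℕ) : ℝ) ^ (3 / 2 : ℝ)) := by
          rw [mul_div_assoc, ← Real.rpow_natCast _ 2, ← Real.rpow_sub hkpos,
            one_div (_ ^ (3 / 2 : ℝ)), ← Real.rpow_neg hkpos.le]
          norm_num
  have hB : ∑' k, P (B k) = ⊤ := by
    let f : ℕ → ℝ := fun k => 1 / (k * (1 + Real.log k))
    have hf0 : ∀ k, 0 ≤ f k := fun k => by
      have := Real.log_natCast_nonneg k
      positivity
    have hns : ¬ Summable fun k => Real.exp (-2) / 2 * f (k + 1) := by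
      rw [summable_mul_left_iff (by positivity), summable_nat_add_iff]
      exact not_summable_one_div_mul_one_add_log
    refine tsum_eq_top_of_eventually_ofReal_le
      (fun k => mul_nonneg (by positivity) (hf0 _)) hns ?_
    filter_upwards [hN.eventually hlarge] with k ⟨h1, h2, h3, h4⟩
    have hNpos : 0 < N (k + 1) := by
      simp only [N]
      positivity
    have hNpos' : (0 : ℝ) < N (k + 1) := by exact_mod_cast hNpos
    have hp0 : 0 ≤ 1 - Real.log (Real.log (N (k + 1))) / N (k + 1) := by
      rw [sub_nonneg, div_le_one hNpos']
      linarith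
    have hone : ∀ i, P (Y i ⁻¹' Set.Iic (u (N (k + 1))))
        = ENNReal.ofReal (1 - Real.log (Real.log (N (k + 1))) / N (k + 1)) := fun i => by
      rw [← compl_compl (Y i ⁻¹' Set.Iic (u (N (k + 1)))), ← Set.preimage_compl, Set.compl_Iic,
        prob_compl_eq_one_sub (hY_meas i measurableSet_Ioi)]
      change 1 - P {ω | u (N (k + 1)) < Y i ω} = _
      rw [htail _ h1 h2 h3, ENNReal.ofReal_sub _ (by positivity), ENNReal.ofReal_one]
    have hPB : P (B k) = ENNReal.ofReal
        ((1 - Real.log (Real.log (N (k + 1))) / N (k + 1)) ^ (N (k + 1) - N k)) := by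
      simp only [B]
      rw [hY.measure_inter_preimage_eq_mul (Finset.Ico (N k) (N (k + 1)))
          (sets := fun _ => Set.Iic (u (N (k + 1)))) fun _ _ => measurableSet_Iic,
        Finset.prod_congr rfl fun i _ => hone i, Finset.prod_const, Nat.card_Ico,
        ← ENNReal.ofReal_pow hp0]
    rw [hPB]
    refine ENNReal.ofReal_le_ofReal ?_
    have hklog := Real.log_natCast_nonneg (k + 1)
    have hkpos : (0 : ℝ) < (k + 1 : ℕ) := by positivity
    calc Real.exp (-2) / 2 * f (k + 1)
        = Real.exp (-2) / (2 * (((k + 1 : ℕ) : ℝ) * (1 + Real.log (k + 1 : ℕ)))) := by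
          simp only [f]
          rw [div_mul_div_comm, mul_one]
      _ ≤ Real.exp (-2) / Real.log (N (k + 1)) := by
          have := log_factorial_sq_le (k + 1)
          gcongr
          refine this.trans ?_
          gcongr
          linarith
      _ = Real.exp (-(Real.log (Real.log (N (k + 1))) + 2)) := by
          rw [neg_add, Real.exp_add, Real.exp_neg (Real.log _), Real.exp_log h1]
          ring
      _ ≤ (1 - Real.log (Real.log (N (k + 1))) / N (k + 1)) ^ N (k + 1) :=
          exp_neg_add_two_le_one_sub_div_pow hNpos h3 h4
      _ ≤ _ := by
          -- The block has fewer than N (k+1) observations, which only raises the power of a base in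
          -- [0,1].
          refine pow_le_pow_of_le_one hp0 ?_ (Nat.sub_le _ _)
          have : 0 ≤ Real.log (Real.log (N (k + 1))) / N (k + 1) := by positivity
          linarith
  have hBmeas : ∀ k, MeasurableSet (B k) := fun k =>
    Finset.measurableSet_biInter _ fun i _ => hY_meas i measurableSet_Iic
  have hlimsup := measure_limsup_eq_one hBmeas
    (iIndepSet_biInter_Ico_preimage hY_meas hY hNmono fun k => measurableSet_Iic) hB
  filter_upwards [(mem_ae_iff_prob_eq_one (MeasurableSet.measurableSet_limsup hBmeas)).2 hlimsup,
    ae_eventually_notMem hC] with ω h1 h2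
  rw [mem_limsup_iff_frequently_mem] at h1
  refine hN.frequently ((h1.and_eventually h2).mono fun k hk i hi => ?_)
  obtain ⟨hkB, hkC⟩ := hk
  by_cases hik : i < N k
  · by_contra hno
    exact hkC (Set.mem_biUnion (Finset.mem_coe.2 (Finset.mem_range.2 hik)) (not_le.1 hno))
  · exact Set.mem_iInter₂.1 hkB i (Finset.mem_Ico.2 ⟨not_lt.1 hik, hi⟩)

/-- If no observation exceeds t in one coordinate, the point at height t on that axis is undominated
and has sum t. -/
theorem ae_frequently_frontierMin_le [IsProbabilityMeasure P]
    (hd : 1 ≤ d) (hX_meas : ∀ i, Measurable (X i))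
    (hX_indep : iIndepFun X P)
    (hX_exp : ∀ i j, P.map (fun ω => X i ω j) = expMeasure 1) :
    ∀ᵐ ω ∂P, ∃ᶠ n : ℕ in atTop, frontierMin (fun i => X i ω) n
      ≤ Real.log n - Real.log (Real.log (Real.log n)) := by
  let a : Fin d := ⟨0, hd⟩
  filter_upwards [ae_forall_coord_pos hX_meas hX_exp,
    ae_frequently_forall_lt_coord_le hX_meas hX_indep hX_exp a] with ω hpos hfreq
  refine (hfreq.and_eventually (eventually_gt_atTop 0)).mono fun n ⟨hn, hn0⟩ => ?_
  refine (frontierMin_le_iff hd ⟨0, hn0, hpos 0⟩).2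
    ⟨Pi.single a (Real.log n - Real.log (Real.log (Real.log n))), ⟨?_, fun i hi h => ?_⟩, by simp⟩
  · exact Pi.single_nonneg.2 ((hpos 0 a).le.trans (hn 0 hn0))
  · exact (hn i hi).not_gt (by simpa using h a)

end

/-! ### Assembly and the two convergence statements -/

theorem eventually_three_mul_log_log_log_le {ε : ℝ} (hε : 0 < ε) :
    ∀ᶠ n : ℕ in atTop, 3 * Real.log (Real.log (Real.log n)) ≤ ε * Real.log (Real.log n) := by
  have h := Real.isLittleO_log_id_atTop.bound (c := ε / 3) (by positivity)
  filter_upwards [tendsto_log_log_natCast_atTop.eventually h,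
    tendsto_log_log_natCast_atTop.eventually_ge_atTop 0] with n hn h0
  simp only [id, Real.norm_eq_abs, abs_of_nonneg h0] at hn
  linarith [le_abs_self (Real.log (Real.log (Real.log n)))]

theorem theoremT {d : ℕ} (hd : 1 ≤ d)
    {Ω : Type*} [MeasurableSpace Ω] (P : Measure Ω) [IsProbabilityMeasure P]
    (X : ℕ → Ω → Fin d → ℝ)
    (hX_meas : ∀ i, Measurable (X i))
    (hX_indep : iIndepFun X P)
    (hX_coord : ∀ i, iIndepFun (fun (j : Fin d) (ω : Ω) => X i ω j) P)
    (hX_exp : ∀ i j, P.map (fun ω => X i ω j) = expMeasure 1)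
    (F : ℕ → Ω → ℝ) (hF : ∀ n ω, F n ω = frontierMin (fun i => X i ω) n) :
    -- (a)
    (Tendsto (fun n : ℕ =>
        P {ω | F n ω ≤ Real.log n - 3 * Real.log (Real.log (Real.log n))}) atTop (𝓝 0)) ∧
    (∀ c : ℕ → ℝ, Tendsto c atTop atTop →
      Tendsto (fun n : ℕ => P {ω | Real.log n + c n ≤ F n ω}) atTop (𝓝 0)) ∧
    -- (b)
    (2 ≤ d → ∀ c : ℝ, 0 < c →
      P {ω | ∃ᶠ n : ℕ in atTop, Real.log n + c * Real.log (Real.log n) ≤ F n ω} = 0) ∧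
    -- (c1)
    (P {ω | ∃ᶠ n : ℕ in atTop,
        F n ω ≤ Real.log n - 3 * Real.log (Real.log (Real.log n))} = 0) ∧
    -- (c2)
    (P {ω | ∃ᶠ n : ℕ in atTop,
        F n ω ≤ Real.log n - Real.log (Real.log (Real.log n))} = 1) ∧
    -- consequence: convergence in probability
    (TendstoInMeasure P
      (fun (n : ℕ) (ω : Ω) => (F n ω - Real.log n) / Real.log (Real.log n)) atTop
      (fun _ => (0 : ℝ))) ∧
    -- consequence: almost sure convergence
    (2 ≤ d → ∀ᵐ ω ∂P,
      Tendsto (fun n : ℕ => (F n ω - Real.log n) / Real.log (Real.log n)) atTop (𝓝 0)) := by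
  obtain rfl : F = fun n ω => frontierMin (fun i => X i ω) n := by
    ext n ω
    exact hF n ω
  have hpos := ae_forall_coord_pos hX_meas hX_exp
  have hlow := tsum_measure_exists_mem_recordRegion_ne_top hX_meas hX_indep hX_coord hX_exp
  have hlow' := eventually_frontierMin_le_ae_le_dyadic hd hpos
  have ha1 := tendsto_measure_of_ae_le_dyadic hlow hlow'
  have ha2 : ∀ c : ℕ → ℝ, Tendsto c atTop atTop → _ := fun c hc =>
    tendsto_measure_le_frontierMin hd hX_meas hX_coord hX_exp hc
  have hb : 2 ≤ d → ∀ c : ℝ, 0 < c → _ := fun h2 c hc =>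
    measure_frequently_eq_zero_of_ae_le_dyadic
      (tsum_measure_forall_exists_lt_ne_top h2 hX_meas hX_indep hX_coord hX_exp hc)
      (eventually_le_frontierMin_ae_le_dyadic hd hpos hc)
  have hc1 := measure_frequently_eq_zero_of_ae_le_dyadic hlow hlow'
  refine ⟨ha1, ha2, hb, hc1, ?_, ?_, ?_⟩
  · rw [← measure_univ (μ := P)]
    refine measure_congr (eventuallyEq_univ.2 ?_)
    exact ae_frequently_frontierMin_le hd hX_meas hX_indep hX_exp
  · rw [tendstoInMeasure_iff_norm]
    intro ε hε
    -- Upper deviations use c_n = ε ln_2 n; lower ones are absorbed since 3 ln_3 n ≤ ε ln_2 n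
    -- eventually.
    have hsum := ha1.add (ha2 (fun n => ε * Real.log (Real.log n))
      (tendsto_log_log_natCast_atTop.const_mul_atTop hε))
    rw [add_zero] at hsum
    refine tendsto_of_tendsto_of_tendsto_of_le_of_le' tendsto_const_nhds hsum
      (Eventually.of_forall fun _ => zero_le) ?_
    filter_upwards [eventually_three_mul_log_log_log_le hε,
      tendsto_log_log_natCast_atTop.eventually_gt_atTop 0] with n hn h0
    refine (measure_mono fun ω hω => ?_).trans (measure_union_le _ _)
    change ε ≤ ‖_‖ at hω
    rw [sub_zero, Real.norm_eq_abs, le_abs, ← neg_div, le_div_iff₀ h0, le_div_iff₀ h0] at hω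
    rcases hω with h | h
    · right
      rw [Set.mem_ofPred_eq]
      linarith
    · left
      rw [Set.mem_ofPred_eq]
      linarith
  · intro h2
    -- Countably many constants 1/(m+1) suffice, so the exceptional null sets can be united.
    have hb' : ∀ m : ℕ, ∀ᵐ ω ∂P, ¬ ∃ᶠ n : ℕ in atTop,
        Real.log n + 1 / ((m : ℝ) + 1) * Real.log (Real.log n)
          ≤ frontierMin (fun i => X i ω) n := fun m => by
      simp only [ae_iff, not_not]
      exact hb h2 (1 / ((m : ℝ) + 1)) (by positivity)
    have hc1' : ∀ᵐ ω ∂P, ¬ ∃ᶠ n : ℕ in atTop, frontierMin (fun i => X i ω) n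
        ≤ Real.log n - 3 * Real.log (Real.log (Real.log n)) := by
      simp only [ae_iff, not_not]
      exact hc1
    filter_upwards [ae_all_iff.2 hb', hc1'] with ω hup hdown
    rw [Metric.tendsto_nhds]
    intro ε hε
    obtain ⟨m, hm⟩ := exists_nat_one_div_lt hε
    filter_upwards [not_frequently.1 (hup m), not_frequently.1 hdown,
      eventually_three_mul_log_log_log_le hε,
      tendsto_log_log_natCast_atTop.eventually_gt_atTop 0] with n h1 h3 hn h0
    rw [Real.dist_eq, sub_zero, abs_lt, lt_div_iff₀ h0, div_lt_iff₀ h0]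
    have := mul_lt_mul_of_pos_right hm h0
    constructor <;> linarith
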